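/- Let $A$ be an $f$-algebra, that is, a real associative algebra (not necessarily unital) which is at the same time a vector lattice such that $a,b\ge 0$ implies $ab\ge 0$, and such that $a\wedge b=0$ and $c\ge 0$ imply $ac\wedge b=ca\wedge b=0$. Assume that $A$ is - Archimedean: if $x,y\in A$, $x\ge 0$ and $nx\le y$ for all $n\in\mathbb{N}$, then $x=0$; - semiprime: $0$ is the only nilpotent element of $A$; - relatively uniformly complete: for every $e\in A$ with $e\ge 0$, every $e$-uniform Cauchy sequence in $A$ (a sequence $(u_n)$ such that for every real $\varepsilon>0$ there is $N$ with $|u_m-u_n|\le\varepsilon e$ for all $m,n\ge N$) has an $e$-uniform limit in $A$ (an element $x$ such that for every real $\varepsilon>0$ there is $N$ with $|u_n-x|\le\varepsilon e$ for all $n\ge N$). Then $A$ is bounded quasi-inversion closed: every $a\in A$ with $|a|\le|a^2-a|$ is quasi-invertible, i.e. there is $b\in A$ with $a+b=ab$. -/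

import Mathlib

namespace VectorLattice

variable (L : Type*) [AddCommGroup L] [Lattice L] [Module ℝ L]

/-- A vector lattice is Archimedean when `0` is the only positive element all of whose natural
multiples have a common upper bound. This is not the type class `Archimedean`, which would ask
every strictly positive element to be a strong order unit. -/
def IsArchimedean : Prop :=
  ∀ x y : L, 0 ≤ x → (∀ n : ℕ, n • x ≤ y) → x = 0

variable {L}

/-- The sequence `u` converges `e`-uniformly to `x`. -/
def TendstoUniformlyRel (e : L) (u : ℕ → L) (x : L) : Prop :=
  ∀ ε : ℝ, 0 < ε → ∃ N : ℕ, ∀ n ≥ N, |u n - x| ≤ ε • e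

/-- The sequence `u` is an `e`-uniform Cauchy sequence. -/
def IsCauchyRel (e : L) (u : ℕ → L) : Prop :=
  ∀ ε : ℝ, 0 < ε → ∃ N : ℕ, ∀ m ≥ N, ∀ n ≥ N, |u m - u n| ≤ ε • e

variable (L)

/-- Relatively uniform completeness: for every positive `e`, every `e`-uniform Cauchy sequence
has an `e`-uniform limit. -/
def IsRelUniformlyComplete : Prop :=
  ∀ e : L, 0 ≤ e → ∀ u : ℕ → L, IsCauchyRel e u → ∃ x : L, TendstoUniformlyRel e u x

end VectorLattice

/-- An `f`-algebra: a real associative algebra (not necessarily unital or commutative) that is a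
vector lattice, with the positive cone closed under multiplication and with multiplication by
positive elements preserving disjointness in the following sense. -/
class IsFAlgebra (A : Type*) [NonUnitalRing A] [Module ℝ A] [IsScalarTower ℝ A A]
    [SMulCommClass ℝ A A] [Lattice A] [IsOrderedAddMonoid A] [IsOrderedModule ℝ A] : Prop where
  mul_nonneg : ∀ a b : A, 0 ≤ a → 0 ≤ b → 0 ≤ a * b
  mul_right_inf : ∀ a b c : A, a ⊓ b = 0 → 0 ≤ c → (a * c) ⊓ b = 0
  mul_left_inf : ∀ a b c : A, a ⊓ b = 0 → 0 ≤ c → (c * a) ⊓ b = 0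

namespace FAlgebra

variable {A : Type*} [NonUnitalRing A]

/-- `succPow a n` is the power of `a` with exponent `n + 1` (there need not be a unit). -/
def succPow (a : A) : ℕ → A
  | 0 => a
  | n + 1 => succPow a n * a

variable (A) in
/-- `0` is the only nilpotent element. -/
def IsSemiprime : Prop :=
  ∀ a : A, (∃ n : ℕ, succPow a n = 0) → a = 0

/-- `a` has a quasi-inverse `b`. -/
def IsQuasiInvertible (a : A) : Prop :=
  ∃ b : A, a + b = a * b

variable (A) in
/-- Every `a` with `|a| ≤ |a² - a|` is quasi-invertible. -/
def IsBoundedQuasiInversionClosed [Lattice A] : Prop :=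
  ∀ a : A, |a| ≤ |a * a - a| → IsQuasiInvertible a

end FAlgebra

/-!
A quasi-inverse of `a` is a solution `b` of `(a - 1) b = a`, where `a - 1` stands for the operator
`x ↦ a * x - x`. It is enough to solve `(1 - a)² x = y` for `y = a⁺` and `y = a⁻`, since then
`b = (a - 1) (x₁ - x₂)` works.

Everything happens in the band of `a` (`FAlgebra.annBand`). Semiprimeness makes multiplication by
`a²` reflect positivity there (`FAlgebra.nonneg_of_mul_mul_nonneg`), so that inequalities between
operators involving the missing unit can be tested after multiplication by `a²`, where the operators
become multiplications by elements of `A`. In this way the hypothesis `|a| ≤ |a² - a|` yields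
`|z| ≤ |(1 - a)² z|` for every `z` in the band (`FAlgebra.abs_le_abs_sqMulSub`).

To solve `(1 - a)² x = y` approximately, let `t > 0` be small and replace `y ≥ 0` by
`v = (y - t (1 - a)² y)⁺`, at a cost of at most `t (1 - a)² y`. On `v` the operator `t (1 - a)²`
lies between `t` and `1`, so a long partial sum of the geometric series of `1 - t (1 - a)²` inverts it up
to a small multiple of `v` (`FAlgebra.exists_approx_sqMulSub_eq`). The lower bound on `(1 - a)²`
turns small residuals into a uniform Cauchy sequence, and its limit is an exact solution by the
Archimedean property (`FAlgebra.exists_sqMulSub_eq`).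

Only powers of `a` ever have to commute with each other, so the commutativity of Archimedean
`f`-algebras is not needed.
-/

/-! ### Disjointness and absolute values in vector lattices -/

namespace VectorLattice

section Lattice

variable {L : Type*} [AddCommGroup L] [Lattice L] [IsOrderedAddMonoid L]

theorem posPart_sub_of_inf_eq_zero {u v : L} (h : u ⊓ v = 0) : (u - v)⁺ = u := by
  have h₁ := sup_eq_add_posPart_sub u v
  have h₂ := inf_add_sup u v
  rw [h, zero_add, h₁, add_comm u v] at h₂
  exact add_left_cancel h₂

theorem abs_sub_of_inf_eq_zero {u v : L} (h : |u| ⊓ |v| = 0) : |u - v| = |u| + |v| := by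
  apply le_antisymm
  · simpa [sub_eq_add_neg] using abs_add_le u (-v)
  · have h₁ := inf_add_sup |u| |v|
    have h₂ := sup_sub_inf_eq_abs_sub |u| |v|
    rw [h, zero_add] at h₁
    rw [h, sub_zero, h₁, abs_sub_comm] at h₂
    rw [h₂]
    exact abs_abs_sub_abs_le u v

theorem nonneg_of_posPart_neg_eq_zero {u : L} (h : (-u)⁺ = 0) : 0 ≤ u := by
  have := le_posPart (-u)
  rw [h] at this
  exact neg_nonpos.mp this

theorem abs_eq_zero_iff {x : L} : |x| = 0 ↔ x = 0 := by
  refine ⟨fun h => le_antisymm ((le_abs_self x).trans h.le) ?_, fun h => by simp [h]⟩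
  exact neg_nonpos.mp ((neg_le_abs x).trans h.le)

/-- In an Archimedean vector lattice, an element below arbitrarily small multiples of a fixed
element in absolute value vanishes. -/
theorem IsArchimedean.eq_zero_of_abs_le [Module ℝ L] [IsOrderedModule ℝ L]
    (hArch : IsArchimedean L) {x e : L} (h : ∀ ε : ℝ, 0 < ε → |x| ≤ ε • e) : x = 0 := by
  rw [← abs_eq_zero_iff]
  refine hArch |x| e (abs_nonneg x) fun n => ?_
  rcases Nat.eq_zero_or_pos n with rfl | hn
  · simpa using (abs_nonneg x).trans (h 1 one_pos)
  · have hn' : (0 : ℝ) < n := by exact_mod_cast hn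
    have h₁ := smul_le_smul_of_nonneg_left (h (n : ℝ)⁻¹ (inv_pos.mpr hn')) hn'.le
    rwa [smul_smul, mul_inv_cancel₀ hn'.ne', one_smul, Nat.cast_smul_eq_nsmul] at h₁

end Lattice

end VectorLattice

namespace FAlgebra

open VectorLattice

/-! ### The band of an element and the operators built from `1 - a` -/

section Algebra

variable {A : Type*} [NonUnitalRing A] [Module ℝ A]

section

variable [IsScalarTower ℝ A A]

/-- The elements annihilated on the right by everything that `a` annihilates. In a semiprime
`f`-algebra this is the band generated by `a`; phrased through products, it is visibly a
subspace. -/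
def annBand (a : A) : Submodule ℝ A where
  carrier := {z | ∀ w, a * w = 0 → z * w = 0}
  zero_mem' := fun w _ => zero_mul w
  add_mem' := fun hx hy w hw => by rw [add_mul, hx w hw, hy w hw, add_zero]
  smul_mem' := fun r x hx w hw => by rw [smul_mul_assoc, hx w hw, smul_zero]

theorem self_mem_annBand (a : A) : a ∈ annBand a := fun _ hw => hw

theorem mul_mem_annBand {a z : A} (c : A) (hz : z ∈ annBand a) : c * z ∈ annBand a :=
  fun w hw => by rw [mul_assoc, hz w hw, mul_zero]

end

variable [SMulCommClass ℝ A A]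

/-- The operator `x ↦ a * x - x`; `b` is a quasi-inverse of `a` exactly when it maps `b` to `a`. -/
def mulSub (a : A) : Module.End ℝ A := LinearMap.mulLeft ℝ a - 1

@[simp]
theorem mulSub_apply (a x : A) : mulSub a x = a * x - x := rfl

/-- The operator `x ↦ (1 - a)² * x`, written without a unit. -/
def sqMulSub (a : A) : Module.End ℝ A := mulSub a * mulSub a

theorem sqMulSub_apply (a x : A) : sqMulSub a x = mulSub a (mulSub a x) := rfl

theorem mul_mul_sqMulSub (a x : A) :
    a * (a * sqMulSub a x) = (a * a - a) * ((a * a - a) * x) := by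
  simp only [sqMulSub_apply, mulSub_apply, mul_sub, sub_mul, mul_assoc]

/-- The operator `x ↦ (1 - t (1 - a)²) * x`, written without a unit. -/
def residual (a : A) (t : ℝ) : Module.End ℝ A := 1 - t • sqMulSub a

theorem residual_apply (a : A) (t : ℝ) (x : A) : residual a t x = x - t • sqMulSub a x := rfl

theorem mul_residual_comm (a : A) (t : ℝ) (x : A) :
    a * residual a t x = residual a t (a * x) := by
  simp only [residual_apply, sqMulSub_apply, mulSub_apply, mul_sub, mul_smul_comm]

variable [IsScalarTower ℝ A A]

theorem mulSub_mem_annBand {a z : A} (hz : z ∈ annBand a) : mulSub a z ∈ annBand a :=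
  (annBand a).sub_mem (mul_mem_annBand a hz) hz

theorem sqMulSub_mem_annBand {a z : A} (hz : z ∈ annBand a) : sqMulSub a z ∈ annBand a :=
  mulSub_mem_annBand (mulSub_mem_annBand hz)

theorem residual_mem_annBand {a z : A} (t : ℝ) (hz : z ∈ annBand a) :
    residual a t z ∈ annBand a :=
  (annBand a).sub_mem hz ((annBand a).smul_mem t (sqMulSub_mem_annBand hz))

/-- Although `residual a t` need not be multiplication by an element, it becomes one after
multiplication by `a²`. -/
theorem mul_mul_residual (a : A) (t : ℝ) (x : A) :
    a * (a * residual a t x) = residual a t (a * a) * x := by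
  simp only [residual_apply, sqMulSub_apply, mulSub_apply, mul_sub, sub_mul, mul_assoc,
    mul_smul_comm, smul_mul_assoc]

end Algebra

/-! ### Order and multiplication in `f`-algebras -/

variable {A : Type*} [NonUnitalRing A] [Module ℝ A] [IsScalarTower ℝ A A]
    [SMulCommClass ℝ A A] [Lattice A] [IsOrderedAddMonoid A] [IsOrderedModule ℝ A]
    [IsFAlgebra A]

theorem mul_le_mul_of_nonneg_left {x y c : A} (h : x ≤ y) (hc : 0 ≤ c) : c * x ≤ c * y := by
  have := IsFAlgebra.mul_nonneg c (y - x) hc (sub_nonneg.mpr h)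
  rwa [mul_sub, sub_nonneg] at this

theorem mul_le_mul_of_nonneg_right {x y c : A} (h : x ≤ y) (hc : 0 ≤ c) : x * c ≤ y * c := by
  have := IsFAlgebra.mul_nonneg (y - x) c (sub_nonneg.mpr h) hc
  rwa [sub_mul, sub_nonneg] at this

theorem posPart_mul_of_nonneg (x : A) {y : A} (hy : 0 ≤ y) : (x * y)⁺ = x⁺ * y := by
  have h := IsFAlgebra.mul_right_inf x⁺ x⁻ y (posPart_inf_negPart_eq_zero x) hy
  rw [inf_comm] at h
  have h' := IsFAlgebra.mul_right_inf x⁻ (x⁺ * y) y h hy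
  rw [inf_comm] at h'
  have := posPart_sub_of_inf_eq_zero h'
  rwa [← sub_mul, posPart_sub_negPart] at this

theorem posPart_nonneg_mul {c : A} (hc : 0 ≤ c) (x : A) : (c * x)⁺ = c * x⁺ := by
  have h := IsFAlgebra.mul_left_inf x⁺ x⁻ c (posPart_inf_negPart_eq_zero x) hc
  rw [inf_comm] at h
  have h' := IsFAlgebra.mul_left_inf x⁻ (c * x⁺) c h hc
  rw [inf_comm] at h'
  have := posPart_sub_of_inf_eq_zero h'
  rwa [← mul_sub, posPart_sub_negPart] at this

theorem abs_mul_of_nonneg (x : A) {y : A} (hy : 0 ≤ y) : |x * y| = |x| * y := by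
  rw [← posPart_add_negPart, ← posPart_add_negPart x, add_mul, posPart_mul_of_nonneg x hy,
    ← posPart_neg, ← neg_mul, posPart_mul_of_nonneg (-x) hy, posPart_neg]

/-- Band preservation makes `|x| * y⁺` and `|x| * y⁻` disjoint, so the absolute values of
`x * y⁺` and `x * y⁻` add up. -/
theorem abs_mul (x y : A) : |x * y| = |x| * |y| := by
  have h := IsFAlgebra.mul_left_inf y⁺ y⁻ |x| (posPart_inf_negPart_eq_zero y) (abs_nonneg x)
  rw [inf_comm] at h
  have h' := IsFAlgebra.mul_left_inf y⁻ (|x| * y⁺) |x| h (abs_nonneg x)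
  rw [inf_comm, ← abs_mul_of_nonneg x (posPart_nonneg y),
    ← abs_mul_of_nonneg x (negPart_nonneg y)] at h'
  have := abs_sub_of_inf_eq_zero h'
  rwa [← mul_sub, posPart_sub_negPart, abs_mul_of_nonneg x (posPart_nonneg y),
    abs_mul_of_nonneg x (negPart_nonneg y), ← mul_add, posPart_add_negPart] at this

theorem mul_eq_zero_of_inf_eq_zero {x y : A} (h : x ⊓ y = 0) : x * y = 0 := by
  have hx : 0 ≤ x := h ▸ inf_le_left
  have hy : 0 ≤ y := h ▸ inf_le_right
  have h₁ := IsFAlgebra.mul_right_inf x y y h hy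
  rw [inf_comm] at h₁
  simpa using IsFAlgebra.mul_left_inf _ _ x h₁ hx

theorem mul_self_eq_abs_mul_abs (x : A) : x * x = |x| * |x| := by
  have h₁ := mul_eq_zero_of_inf_eq_zero (posPart_inf_negPart_eq_zero x)
  have h₂ := mul_eq_zero_of_inf_eq_zero (inf_comm x⁺ x⁻ ▸ posPart_inf_negPart_eq_zero x)
  rw [← posPart_add_negPart x]
  nth_rw 1 2 [← posPart_sub_negPart x]
  simp only [sub_mul, mul_sub, add_mul, mul_add, h₁, h₂]
  abel

theorem mul_self_nonneg (x : A) : 0 ≤ x * x := by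
  rw [mul_self_eq_abs_mul_abs]
  exact IsFAlgebra.mul_nonneg _ _ (abs_nonneg x) (abs_nonneg x)

/-- No commutativity is assumed, so `(a * w)² = 0` is not immediate; instead the infimum `g` of
`|a|` and `|w|` satisfies `g³ = 0`, so `a` and `w` are disjoint. -/
theorem mul_eq_zero_of_mul_mul_eq_zero (hSemi : IsSemiprime A) {a w : A}
    (h : a * (a * w) = 0) : a * w = 0 := by
  have hg0 : 0 ≤ |a| ⊓ |w| := le_inf (abs_nonneg a) (abs_nonneg w)
  have h3 : |a| * (|a| * |w|) = 0 := by rw [← abs_mul, ← abs_mul, h, abs_zero]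
  have hg : |a| ⊓ |w| = 0 := by
    refine hSemi _ ⟨2, le_antisymm ?_ (IsFAlgebra.mul_nonneg _ _
      (IsFAlgebra.mul_nonneg _ _ hg0 hg0) hg0)⟩
    change (|a| ⊓ |w|) * (|a| ⊓ |w|) * (|a| ⊓ |w|) ≤ 0
    rw [mul_assoc, ← h3]
    calc (|a| ⊓ |w|) * ((|a| ⊓ |w|) * (|a| ⊓ |w|))
        ≤ |a| * ((|a| ⊓ |w|) * (|a| ⊓ |w|)) :=
          mul_le_mul_of_nonneg_right inf_le_left (IsFAlgebra.mul_nonneg _ _ hg0 hg0)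
      _ ≤ |a| * (|a| * (|a| ⊓ |w|)) := mul_le_mul_of_nonneg_left
          (mul_le_mul_of_nonneg_right inf_le_left hg0) (abs_nonneg a)
      _ ≤ |a| * (|a| * |w|) := mul_le_mul_of_nonneg_left
          (mul_le_mul_of_nonneg_left inf_le_right (abs_nonneg a)) (abs_nonneg a)
  rw [← abs_eq_zero_iff, abs_mul, mul_eq_zero_of_inf_eq_zero hg]

/-! ### Positivity of operators on the band of `a` -/

theorem posPart_mem_annBand {a z : A} (hz : z ∈ annBand a) : z⁺ ∈ annBand a := fun w hw => by
  rw [← abs_eq_zero_iff]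
  refine le_antisymm ?_ (abs_nonneg _)
  calc |z⁺ * w| = z⁺ * |w| := by rw [abs_mul, abs_of_nonneg (posPart_nonneg z)]
    _ ≤ |z| * |w| := by
      refine mul_le_mul_of_nonneg_right ?_ (abs_nonneg w)
      rw [← posPart_add_negPart z]
      exact le_add_of_nonneg_right (negPart_nonneg z)
    _ = 0 := by rw [← abs_mul, hz w hw, abs_zero]

theorem negPart_mem_annBand {a z : A} (hz : z ∈ annBand a) : z⁻ ∈ annBand a := by
  rw [← posPart_neg]
  exact posPart_mem_annBand ((annBand a).neg_mem hz)

theorem abs_mem_annBand {a z : A} (hz : z ∈ annBand a) : |z| ∈ annBand a := by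
  rw [← posPart_add_negPart z]
  exact (annBand a).add_mem (posPart_mem_annBand hz) (negPart_mem_annBand hz)

/-- Multiplication by `a²` reflects positivity on the band of `a`: a negative part killed by `a²`
is killed by `a`, hence by itself. -/
theorem nonneg_of_mul_mul_nonneg (hSemi : IsSemiprime A) {a z : A} (hz : z ∈ annBand a)
    (h : 0 ≤ a * (a * z)) : 0 ≤ z := by
  have h₁ : a * (a * (-z)⁺) = 0 := by
    rw [← mul_assoc, ← posPart_nonneg_mul (mul_self_nonneg a), mul_neg, mul_assoc, posPart_neg]
    exact negPart_eq_zero.mpr h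
  have h₂ : (-z)⁺ * (-z)⁺ = 0 := posPart_mem_annBand ((annBand a).neg_mem hz) _
    (mul_eq_zero_of_mul_mul_eq_zero hSemi h₁)
  exact nonneg_of_posPart_neg_eq_zero (hSemi _ ⟨1, h₂⟩)

/-- If `|a| ≤ |a² - a|`, then `(1 - a)²` is at least `1` on the band of `a`. Both sides are compared
after multiplication by `a²`, where this is the square of the hypothesis. -/
theorem abs_le_abs_sqMulSub (hSemi : IsSemiprime A) {a : A} (ha : |a| ≤ |a * a - a|) {z : A}
    (hz : z ∈ annBand a) : |z| ≤ |sqMulSub a z| := by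
  rw [← sub_nonneg]
  refine nonneg_of_mul_mul_nonneg hSemi ((annBand a).sub_mem
    (abs_mem_annBand (sqMulSub_mem_annBand hz)) (abs_mem_annBand hz)) ?_
  have habs : ∀ u : A, a * (a * |u|) = |a * (a * u)| := fun u => by
    rw [abs_mul, abs_mul, ← mul_assoc, ← mul_assoc, mul_self_eq_abs_mul_abs]
  rw [mul_sub, mul_sub, sub_nonneg, habs, habs, mul_mul_sqMulSub]
  simp only [abs_mul]
  calc |a| * (|a| * |z|) ≤ |a| * (|a * a - a| * |z|) :=
        mul_le_mul_of_nonneg_left (mul_le_mul_of_nonneg_right ha (abs_nonneg z)) (abs_nonneg a)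
    _ ≤ |a * a - a| * (|a * a - a| * |z|) :=
        mul_le_mul_of_nonneg_right ha
          (IsFAlgebra.mul_nonneg _ _ (abs_nonneg _) (abs_nonneg _))

theorem sqMulSub_nonneg (hSemi : IsSemiprime A) {a z : A} (hz : z ∈ annBand a) (h0 : 0 ≤ z) :
    0 ≤ sqMulSub a z := by
  refine nonneg_of_mul_mul_nonneg hSemi (sqMulSub_mem_annBand hz) ?_
  rw [mul_mul_sqMulSub, ← mul_assoc]
  exact IsFAlgebra.mul_nonneg _ _ (mul_self_nonneg _) h0

theorem le_sqMulSub (hSemi : IsSemiprime A) {a : A} (ha : |a| ≤ |a * a - a|) {z : A}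
    (hz : z ∈ annBand a) (h0 : 0 ≤ z) : z ≤ sqMulSub a z := by
  simpa only [abs_of_nonneg h0, abs_of_nonneg (sqMulSub_nonneg hSemi hz h0)] using
    abs_le_abs_sqMulSub hSemi ha hz

/-- Positivity of `(1 - t (1 - a)²) z`, tested after multiplication by `a⁴`: one factor `a²` turns
the operator into a multiplication by an element, the other does the same for an operator
inside `z`. -/
theorem residual_nonneg (hSemi : IsSemiprime A) {a z : A} (t : ℝ) (hz : z ∈ annBand a)
    (h : 0 ≤ residual a t (a * a) * (a * (a * z))) : 0 ≤ residual a t z := by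
  have hR := residual_mem_annBand t hz
  refine nonneg_of_mul_mul_nonneg hSemi hR (nonneg_of_mul_mul_nonneg hSemi
    (mul_mem_annBand a (mul_mem_annBand a hR)) ?_)
  rwa [mul_residual_comm a t z, mul_residual_comm a t (a * z), mul_mul_residual]

theorem residual_residual_nonneg (hSemi : IsSemiprime A) {a z : A} (t : ℝ) (hz : z ∈ annBand a)
    (h0 : 0 ≤ z) : 0 ≤ residual a t (residual a t z) := by
  refine residual_nonneg hSemi t (residual_mem_annBand t hz) ?_
  rw [mul_mul_residual, ← mul_assoc]
  exact IsFAlgebra.mul_nonneg _ _ (mul_self_nonneg _) h0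

/-- With `c = a² (1 - t (1 - a)²)`, an element of the algebra, the claim becomes
`0 ≤ c * (c⁺ * y) = (c⁺)² * y`. -/
theorem residual_posPart_residual_nonneg (hSemi : IsSemiprime A) {a y : A} (t : ℝ)
    (hy : y ∈ annBand a) (h0 : 0 ≤ y) : 0 ≤ residual a t (residual a t y)⁺ := by
  refine residual_nonneg hSemi t (posPart_mem_annBand (residual_mem_annBand t hy)) ?_
  rw [← mul_assoc a a, ← posPart_nonneg_mul (mul_self_nonneg a), mul_assoc a a, mul_mul_residual,
    posPart_mul_of_nonneg _ h0, ← mul_assoc]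
  generalize residual a t (a * a) = c
  have h : c⁻ ⊓ c⁺ = 0 := by rw [inf_comm, posPart_inf_negPart_eq_zero]
  have hcc : c * c⁺ = c⁺ * c⁺ := calc
    c * c⁺ = (c⁺ - c⁻) * c⁺ := by rw [posPart_sub_negPart]
    _ = c⁺ * c⁺ := by rw [sub_mul, mul_eq_zero_of_inf_eq_zero h, sub_zero]
  rw [hcc]
  exact IsFAlgebra.mul_nonneg _ _ (mul_self_nonneg _) h0

/-! ### Inverting `(1 - a)²` by truncated geometric series -/

/-- On a positive element of the band of `a` where `t (1 - a)²` is at most `1`, the powers of the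
residual decay geometrically, because there `t ≤ t (1 - a)² ≤ 1`. -/
theorem residual_pow_bounds (hSemi : IsSemiprime A) {a : A} (ha : |a| ≤ |a * a - a|) {t : ℝ}
    (ht0 : 0 ≤ t) (ht1 : t ≤ 1) {v : A} (hv : v ∈ annBand a) (hv0 : 0 ≤ v)
    (hRv : 0 ≤ residual a t v) (N : ℕ) :
    (residual a t ^ N) v ∈ annBand a ∧ 0 ≤ (residual a t ^ N) v ∧
      0 ≤ residual a t ((residual a t ^ N) v) ∧ (residual a t ^ N) v ≤ (1 - t) ^ N • v := by
  induction N with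
  | zero => simpa using ⟨hv, hv0, hRv⟩
  | succ N ih =>
    obtain ⟨hB, h0, hR, hle⟩ := ih
    rw [pow_succ', Module.End.mul_apply]
    refine ⟨residual_mem_annBand t hB, hR, residual_residual_nonneg hSemi t hB h0, ?_⟩
    have h₁ := smul_le_smul_of_nonneg_left (le_sqMulSub hSemi ha hB h0) ht0
    have h₂ := smul_le_smul_of_nonneg_left hle (sub_nonneg.mpr ht1)
    rw [pow_succ', mul_smul]
    refine le_trans ?_ h₂
    rw [residual_apply, sub_smul, one_smul]
    exact sub_le_sub_left h₁ _

/-- The equation `(1 - a)² x = y` has approximate solutions, with the error measured relative to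
`(1 - a)² y`: truncated geometric series on a part of `y` where `(1 - a)²` is bounded. -/
theorem exists_approx_sqMulSub_eq (hSemi : IsSemiprime A) {a : A} (ha : |a| ≤ |a * a - a|) {y : A}
    (hy : y ∈ annBand a) (hy0 : 0 ≤ y) {ε : ℝ} (hε : 0 < ε) :
    ∃ x ∈ annBand a, |sqMulSub a x - y| ≤ ε • sqMulSub a y := by
  -- With `t = min (ε / 2) 1`, cutting `y` off to `(y - t (1 - a)² y)⁺` costs at most
  -- `t (1 - a)² y`, and on the cut-off `t (1 - a)²` lies between `t` and `1`.
  obtain ⟨t, ht0, ht1, htε⟩ : ∃ t : ℝ, 0 < t ∧ t ≤ 1 ∧ t ≤ ε / 2 :=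
    ⟨min (ε / 2) 1, by positivity, min_le_right _ _, min_le_left _ _⟩
  obtain ⟨N, hN⟩ := exists_pow_lt_of_lt_one ht0 (sub_lt_self 1 ht0)
  set v := (residual a t y)⁺ with hv_def
  have hv : v ∈ annBand a := posPart_mem_annBand (residual_mem_annBand t hy)
  have hv0 : 0 ≤ v := posPart_nonneg _
  have hTy : y ≤ sqMulSub a y := le_sqMulSub hSemi ha hy hy0
  have htTy : 0 ≤ t • sqMulSub a y := smul_nonneg ht0.le (hy0.trans hTy)
  have hvy : v ≤ y := sup_le (by rw [residual_apply]; exact sub_le_self _ htTy) hy0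
  have hyv : y - v ≤ t • sqMulSub a y := by
    have := le_posPart (residual a t y)
    rw [residual_apply a t y, sub_le_comm] at this
    exact this
  have hpow := residual_pow_bounds hSemi ha ht0.le ht1 hv hv0
    (residual_posPart_residual_nonneg hSemi t hy hy0)
  refine ⟨t • ∑ i ∈ Finset.range N, (residual a t ^ i) v,
    (annBand a).smul_mem t ((annBand a).sum_mem fun i _ => (hpow i).1), ?_⟩
  -- The geometric series: the remainder is the `N`-th power of the residual.
  have hgeom : sqMulSub a (t • ∑ i ∈ Finset.range N, (residual a t ^ i) v)
      = v - (residual a t ^ N) v := by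
    have h := LinearMap.congr_fun (mul_neg_geom_sum (residual a t) N) v
    have h1 : 1 - residual a t = t • sqMulSub a := by rw [residual, sub_sub_cancel]
    rw [h1, Module.End.mul_apply, LinearMap.sum_apply] at h
    rw [map_smul]
    exact h
  have hrem : (residual a t ^ N) v ≤ t • sqMulSub a y := calc
    (residual a t ^ N) v ≤ (1 - t) ^ N • v := (hpow N).2.2.2
    _ ≤ t • v := smul_le_smul_of_nonneg_right hN.le hv0
    _ ≤ t • sqMulSub a y := smul_le_smul_of_nonneg_left (hvy.trans hTy) ht0.le
  have heq : y - (v - (residual a t ^ N) v) = (y - v) + (residual a t ^ N) v := by abel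
  rw [hgeom, abs_sub_comm, heq, abs_of_nonneg (add_nonneg (sub_nonneg.mpr hvy) (hpow N).2.1)]
  calc (y - v) + (residual a t ^ N) v ≤ t • sqMulSub a y + t • sqMulSub a y :=
        add_le_add hyv hrem
    _ = (2 * t) • sqMulSub a y := by rw [two_mul, add_smul]
    _ ≤ ε • sqMulSub a y := smul_le_smul_of_nonneg_right (by linarith) (hy0.trans hTy)

theorem abs_mulSub_le (a : A) {d e : A} {ε : ℝ} (h : |d| ≤ ε • e) :
    |mulSub a d| ≤ ε • (|a| * e + e) := calc
  |mulSub a d| ≤ |a * d| + |d| := by simpa [sub_eq_add_neg] using abs_add_le (a * d) (-d)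
  _ ≤ |a| * (ε • e) + ε • e := by
    rw [abs_mul]
    exact add_le_add (mul_le_mul_of_nonneg_left h (abs_nonneg a)) h
  _ = ε • (|a| * e + e) := by rw [mul_smul_comm, smul_add]

/-- Approximate solutions of `(1 - a)² x = y` form a uniform Cauchy sequence, because `(1 - a)²`
does not decrease absolute values, and their uniform limit is an exact solution. -/
theorem exists_sqMulSub_eq (hArch : IsArchimedean A) (hSemi : IsSemiprime A)
    (hComplete : IsRelUniformlyComplete A) {a : A} (ha : |a| ≤ |a * a - a|) {y : A}
    (hy : y ∈ annBand a) (hy0 : 0 ≤ y) : ∃ x, sqMulSub a x = y := by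
  set e := sqMulSub a y with he_def
  have he : 0 ≤ e := sqMulSub_nonneg hSemi hy hy0
  choose u huB hu using fun n : ℕ =>
    exists_approx_sqMulSub_eq hSemi ha hy hy0 (Nat.one_div_pos_of_nat (α := ℝ) (n := n))
  have hu_le : ∀ ε : ℝ, 0 < ε → ∃ N : ℕ, ∀ n ≥ N, |sqMulSub a (u n) - y| ≤ ε • e := by
    intro ε hε
    obtain ⟨N, hN⟩ := exists_nat_one_div_lt hε
    exact ⟨N, fun n hn => (hu n).trans
      (smul_le_smul_of_nonneg_right ((Nat.one_div_le_one_div hn).trans hN.le) he)⟩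
  obtain ⟨x, hx⟩ := hComplete e he u fun ε hε => by
    obtain ⟨N, hN⟩ := hu_le (ε / 2) (half_pos hε)
    refine ⟨N, fun m hm n hn => ?_⟩
    have hsplit : sqMulSub a (u m - u n)
        = (sqMulSub a (u m) - y) + (y - sqMulSub a (u n)) := by rw [map_sub]; abel
    calc |u m - u n| ≤ |sqMulSub a (u m - u n)| :=
          abs_le_abs_sqMulSub hSemi ha ((annBand a).sub_mem (huB m) (huB n))
      _ ≤ |sqMulSub a (u m) - y| + |y - sqMulSub a (u n)| := hsplit ▸ abs_add_le _ _
      _ ≤ (ε / 2) • e + (ε / 2) • e :=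
          add_le_add (hN m hm) (abs_sub_comm y (sqMulSub a (u n)) ▸ hN n hn)
      _ = ε • e := by rw [← add_smul, add_halves]
  refine ⟨x, sub_eq_zero.mp (hArch.eq_zero_of_abs_le
    (e := |a| * (|a| * e + e) + (|a| * e + e) + e) fun ε hε => ?_)⟩
  obtain ⟨N₁, h₁⟩ := hx ε hε
  obtain ⟨N₂, h₂⟩ := hu_le ε hε
  set n := max N₁ N₂
  have hd : |x - u n| ≤ ε • e := abs_sub_comm x (u n) ▸ h₁ n (le_max_left _ _)
  have hsplit : sqMulSub a x - y = sqMulSub a (x - u n) + (sqMulSub a (u n) - y) := by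
    rw [map_sub]; abel
  rw [hsplit, smul_add]
  exact (abs_add_le _ _).trans
    (add_le_add (abs_mulSub_le a (abs_mulSub_le a hd)) (h₂ n (le_max_right _ _)))

end FAlgebra

/-! ### Quasi-inversion -/

theorem mainTheorem2 {A : Type*} [NonUnitalRing A] [Module ℝ A] [IsScalarTower ℝ A A]
    [SMulCommClass ℝ A A] [Lattice A] [IsOrderedAddMonoid A] [IsOrderedModule ℝ A]
    [IsFAlgebra A]
    (hArch : VectorLattice.IsArchimedean A)
    (hSemi : FAlgebra.IsSemiprime A)
    (hComplete : VectorLattice.IsRelUniformlyComplete A) :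
    FAlgebra.IsBoundedQuasiInversionClosed A := by
  intro a ha
  -- If `(1 - a)² x = a`, then `(a - 1) x` is a quasi-inverse of `a`.
  have haB := FAlgebra.self_mem_annBand a
  obtain ⟨x₁, h₁⟩ := FAlgebra.exists_sqMulSub_eq hArch hSemi hComplete ha
    (FAlgebra.posPart_mem_annBand haB) (posPart_nonneg a)
  obtain ⟨x₂, h₂⟩ := FAlgebra.exists_sqMulSub_eq hArch hSemi hComplete ha
    (FAlgebra.negPart_mem_annBand haB) (negPart_nonneg a)
  refine ⟨FAlgebra.mulSub a (x₁ - x₂), ?_⟩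
  have h : FAlgebra.sqMulSub a (x₁ - x₂) = a := by
    rw [map_sub, h₁, h₂, posPart_sub_negPart]
  rw [FAlgebra.sqMulSub_apply, FAlgebra.mulSub_apply] at h
  exact (eq_sub_iff_add_eq.mp h.symm)
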